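/- **Theorem 1.** Let $(\mathcal E_\theta)$, $\theta\in\mathbb R$, be a family of linear maps on $2\times 2$ complex matrices such that, for all $\theta$ near $0$, $\mathcal E_\theta$ is a qubit channel (a completely positive trace-preserving map), and suppose that near $\theta=0$ the family has a finite Kraus representation $\mathcal E_\theta(X)=\sum_{i=1}^r K_{\theta,i}XK_{\theta,i}^\dagger$ with $\theta\mapsto K_{\theta,i}$ differentiable at $\theta=0$. Suppose that $\mathcal E_0$ is strictly contractive: $\|\mathcal E_0(A)\|_1<\|A\|_1$ for every nonzero traceless Hermitian $A$, where $\|\cdot\|_1$ is the trace norm. Then: 1. For every finite Kraus representation $(K_i)$ of $\mathcal E_0$, the Kraus span $\mathcal S$, i.e. the set of all Hermitian operators in the complex linear span of $\{K_i^\dagger K_j\}_{i,j}$, is the set of all Hermitian $2\times 2$ matrices. 2. The Hamiltonian-not-in-Kraus-span (HNKS) condition is violated: for every finite Kraus representation $(K_{\theta,i})$ of the family near $0$ that is differentiable at $\theta=0$, the Hamiltonian $H=i\sum_j K_{0,j}^\dagger\dot K_{0,j}$ lies in the Kraus span $\mathcal S$ of $(K_{0,i})$, where the dot is the derivative at $\theta=0$.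 3. There is a constant $c\ge 0$, depending only on the family $(\mathcal E_\theta)$, such that for every $n$ the quantum Fisher information at $\theta=0$ of the output state obtained with $n$ uses of $\mathcal E_\theta$ is at most $c\,n$ for each of the following strategies and for all choices of the initial state and of the controls (which do not depend on $\theta$): (a) ancilla-assisted sequential: the output is $\mathcal C_n\circ(\mathcal E_\theta\otimes\mathrm{id})\circ\cdots\circ\mathcal C_1\circ(\mathcal E_\theta\otimes\mathrm{id})(\rho_0)$ with a noiseless ancilla of arbitrary finite dimension and arbitrary channels $\mathcal C_k$ on probe and ancilla; (b) parallel: the output is $(\mathcal E_\theta^{\otimes n}\otimes\mathrm{id})(\rho_0)$ with an arbitrary state $\rho_0$ of $n$ qubit probes and a noiseless ancilla of arbitrary finite dimension; (c) ancilla-free sequential with unital controls: as (a), without ancilla and with unital channels $\mathcal C_k$; (d) ancilla-free sequential: as (a), without ancilla and with arbitrary channels $\mathcal C_k$; (e) bounded-ancilla-assisted sequential with unital controls: as (a), with an ancilla of dimension at most $N$ and unital channels $\mathcal C_k$; here $c$ does not depend on $N$. Here the quantum Fisher information of a family of states $\rho_\theta$ at $\theta=0$ is $F=\mathrm{Tr}(\rho_0L^2)$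 for any Hermitian $L$ with $\tfrac12(L\rho_0+\rho_0L)=\partial_\theta\rho_\theta|_{\theta=0}$ (the value does not depend on $L$), and $F=\infty$ if there is no such $L$. -/

import Mathlib

open scoped Matrix ComplexOrder ENNReal NNReal Topology

namespace QMetro

noncomputable section

/-- Operators on the finite-dimensional Hilbert space with orthonormal basis indexed by `d`. -/
abbrev Op (d : Type) := Matrix d d ℂ

/-! ### States and channels -/

/-- Density operators. -/
def IsState {d : Type} [Fintype d] (ρ : Op d) : Prop :=
  ρ.PosSemidef ∧ ρ.trace = 1

/-- The map `Φ ⊗ id` on operators of the composite system `d × a`. -/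
def ampliate {d : Type} (Φ : Op d →ₗ[ℂ] Op d) (a : Type) : Op (d × a) →ₗ[ℂ] Op (d × a) where
  toFun X := Matrix.of fun p q => Φ (Matrix.of fun i j => X (i, p.2) (j, q.2)) p.1 q.1
  map_add' X Y := by
    ext p q
    exact congrFun (congrFun (map_add Φ (Matrix.of fun i j => X (i, p.2) (j, q.2))
      (Matrix.of fun i j => Y (i, p.2) (j, q.2))) p.1) q.1
  map_smul' c X := by
    ext p q
    exact congrFun (congrFun (map_smul Φ c (Matrix.of fun i j => X (i, p.2) (j, q.2))) p.1) q.1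

/-- Quantum channels: completely positive trace-preserving maps. -/
def IsChannel {d : Type} [Fintype d] (Φ : Op d →ₗ[ℂ] Op d) : Prop :=
  (∀ (k : ℕ) (X : Op (d × Fin k)), X.PosSemidef → (ampliate Φ (Fin k) X).PosSemidef) ∧
    ∀ X : Op d, (Φ X).trace = X.trace

/-- Unital channels. -/
def IsUnitalChannel {d : Type} [Fintype d] [DecidableEq d] (Φ : Op d →ₗ[ℂ] Op d) : Prop :=
  IsChannel Φ ∧ Φ 1 = 1

/-- The trace norm: the sum of the singular values. -/
def traceNorm {d : Type} [Fintype d] [DecidableEq d] (A : Op d) : ℝ :=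
  ∑ i, √((Matrix.isHermitian_conjTranspose_mul_self A).eigenvalues i)

/-- Strict contractivity in trace norm on nonzero traceless Hermitian operators. -/
def StrictlyContractive {d : Type} [Fintype d] [DecidableEq d] (Φ : Op d →ₗ[ℂ] Op d) : Prop :=
  ∀ A : Op d, A.IsHermitian → A.trace = 0 → A ≠ 0 → traceNorm (Φ A) < traceNorm A

/-! ### Kraus representations, Kraus span, the HNKS condition -/

/-- `K` is a Kraus representation of `Φ`. -/
def IsKraus {d : Type} [Fintype d] {r : ℕ} (Φ : Op d →ₗ[ℂ] Op d) (K : Fin r → Op d) : Prop :=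
  ∀ X : Op d, Φ X = ∑ i, K i * X * (K i)ᴴ

/-- `A'` is the (entrywise) derivative at `θ = 0` of the operator-valued function `A`. -/
def HasOpDeriv {d : Type} (A : ℝ → Op d) (A' : Op d) : Prop :=
  ∀ i j, HasDerivAt (fun θ => A θ i j) (A' i j) 0

/-- `K` is a Kraus representation of the one-parameter family `E` near `θ = 0` which is
differentiable at `θ = 0`, with derivatives `K'` there. -/
def IsDiffKraus {d : Type} [Fintype d] {r : ℕ} (E : ℝ → Op d →ₗ[ℂ] Op d)
    (K : ℝ → Fin r → Op d) (K' : Fin r → Op d) : Prop :=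
  (∀ᶠ θ in 𝓝 (0 : ℝ), IsKraus (E θ) (K θ)) ∧ ∀ i, HasOpDeriv (fun θ => K θ i) (K' i)

/-- The Kraus span: all Hermitian operators in the linear span of the products `Kᵢ† Kⱼ`. -/
def krausSpan {d : Type} [Fintype d] {r : ℕ} (K : Fin r → Op d) : Set (Op d) :=
  {X | X.IsHermitian ∧ X ∈ Submodule.span ℂ (Set.range fun p : Fin r × Fin r => (K p.1)ᴴ * K p.2)}

/-- The Hamiltonian `i ∑ⱼ Kⱼ† K'ⱼ`. -/
def krausHamiltonian {d : Type} [Fintype d] {r : ℕ} (K K' : Fin r → Op d) : Op d :=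
  Complex.I • ∑ j, (K j)ᴴ * K' j

/-- The Hamiltonian-not-in-Kraus-span condition at `θ = 0`. -/
def HNKS {d : Type} [Fintype d] (E : ℝ → Op d →ₗ[ℂ] Op d) : Prop :=
  ∃ (r : ℕ) (K : ℝ → Fin r → Op d) (K' : Fin r → Op d),
    IsDiffKraus E K K' ∧ krausHamiltonian (K 0) K' ∉ krausSpan (K 0)

/-! ### Quantum Fisher information -/

/-- `L` is a symmetric logarithmic derivative of the family `ρ` at `θ = 0`. -/
def IsSLD {d : Type} [Fintype d] (ρ : ℝ → Op d) (L : Op d) : Prop :=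
  L.IsHermitian ∧ HasOpDeriv ρ ((1 / 2 : ℂ) • (L * ρ 0 + ρ 0 * L))

/-- The quantum Fisher information `Tr (ρ L²)` of the family `ρ` at `θ = 0`, where `L` is any
symmetric logarithmic derivative (the value does not depend on `L`, see `qfi_eq`); it is `∞` if
there is none. -/
def qfi {d : Type} [Fintype d] (ρ : ℝ → Op d) : ℝ≥0∞ :=
  ⨅ (L : Op d) (_ : IsSLD ρ L), ENNReal.ofReal (ρ 0 * (L * L)).trace.re

theorem qfi_eq {d : Type} [Fintype d] {ρ : ℝ → Op d} {L : Op d} (hL : IsSLD ρ L) :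
    qfi ρ = ENNReal.ofReal (ρ 0 * (L * L)).trace.re := by
  have key : ∀ L' : Op d, IsSLD ρ L' → (ρ 0 * (L' * L')).trace = (ρ 0 * (L * L)).trace := by
    intro L' hL'
    have hD : (1 / 2 : ℂ) • (L' * ρ 0 + ρ 0 * L') = (1 / 2 : ℂ) • (L * ρ 0 + ρ 0 * L) := by
      ext i j
      exact (hL'.2 i j).unique (hL.2 i j)
    have hE : L' * ρ 0 + ρ 0 * L' = L * ρ 0 + ρ 0 * L :=
      smul_right_injective _ (by norm_num : (1 / 2 : ℂ) ≠ 0) hD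
    have h1 := congrArg (fun M => (M * L).trace) hE
    have h2 := congrArg (fun M => (M * L').trace) hE
    simp only [add_mul, Matrix.trace_add] at h1 h2
    have c1 : ∀ A B : Op d, (A * (ρ 0 * B)).trace = (ρ 0 * (B * A)).trace := fun A B => by
      rw [Matrix.trace_mul_comm, Matrix.mul_assoc]
    simp only [Matrix.mul_assoc, c1] at h1 h2
    linear_combination (1 / 2 : ℂ) * h1 + (1 / 2 : ℂ) * h2
  refine le_antisymm (iInf₂_le L hL) (le_iInf₂ fun L' hL' => ?_)
  rw [key L' hL']

/-! ### Strategies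

In each case the value is the supremum of the quantum Fisher information of the output state over
all choices which the strategy leaves open, for `n` uses of `E θ`. -/

/-- The state after `n` rounds, each an application of `Φ` followed by the control `C k`. -/
def seqOutput {d : Type} (Φ : Op d →ₗ[ℂ] Op d) (C : ℕ → Op d →ₗ[ℂ] Op d) (ρ₀ : Op d) : ℕ → Op d
  | 0 => ρ₀
  | k + 1 => C k (Φ (seqOutput Φ C ρ₀ k))

/-- The map `Φ` acting on probe `i` of `n` probes, and trivially on the others and on the
ancilla. -/
def onProbe {d a : Type} {n : ℕ} (Φ : Op d →ₗ[ℂ] Op d) (i : Fin n)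
    (X : Op ((Fin n → d) × a)) : Op ((Fin n → d) × a) :=
  Matrix.of fun p q => Φ (Matrix.of fun s t =>
    X (Function.update p.1 i s, p.2) (Function.update q.1 i t, q.2)) (p.1 i) (q.1 i)

/-- The map `Φ ⊗ ⋯ ⊗ Φ ⊗ id` on `n` probes and an ancilla: `Φ` acts once on each probe. -/
def onAllProbes {d a : Type} {n : ℕ} (Φ : Op d →ₗ[ℂ] Op d)
    (X : Op ((Fin n → d) × a)) : Op ((Fin n → d) × a) :=
  (List.finRange n).foldr (fun i Y => onProbe Φ i Y) X

/-- (a) Ancilla-assisted sequential strategies: noiseless ancilla of any size, any channels as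
controls. -/
def qfiAncillaSeq (E : ℝ → Op (Fin 2) →ₗ[ℂ] Op (Fin 2)) (n : ℕ) : ℝ≥0∞ :=
  ⨆ (a : ℕ) (ρ₀ : Op (Fin 2 × Fin a)) (_ : IsState ρ₀)
    (C : ℕ → Op (Fin 2 × Fin a) →ₗ[ℂ] Op (Fin 2 × Fin a)) (_ : ∀ k, IsChannel (C k)),
    qfi fun θ => seqOutput (ampliate (E θ) (Fin a)) C ρ₀ n

/-- (b) Parallel strategies: one use of the channel on each of `n` probes, which may be entangled
with one another and with a noiseless ancilla of any size. -/
def qfiParallel (E : ℝ → Op (Fin 2) →ₗ[ℂ] Op (Fin 2)) (n : ℕ) : ℝ≥0∞ :=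
  ⨆ (a : ℕ) (ρ₀ : Op ((Fin n → Fin 2) × Fin a)) (_ : IsState ρ₀),
    qfi fun θ => onAllProbes (E θ) ρ₀

/-- (c) Ancilla-free sequential strategies with unital controls. -/
def qfiSeqUnital (E : ℝ → Op (Fin 2) →ₗ[ℂ] Op (Fin 2)) (n : ℕ) : ℝ≥0∞ :=
  ⨆ (ρ₀ : Op (Fin 2)) (_ : IsState ρ₀)
    (C : ℕ → Op (Fin 2) →ₗ[ℂ] Op (Fin 2)) (_ : ∀ k, IsUnitalChannel (C k)),
    qfi fun θ => seqOutput (E θ) C ρ₀ n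

/-- (d) Ancilla-free sequential strategies with any channels as controls. -/
def qfiSeq (E : ℝ → Op (Fin 2) →ₗ[ℂ] Op (Fin 2)) (n : ℕ) : ℝ≥0∞ :=
  ⨆ (ρ₀ : Op (Fin 2)) (_ : IsState ρ₀)
    (C : ℕ → Op (Fin 2) →ₗ[ℂ] Op (Fin 2)) (_ : ∀ k, IsChannel (C k)),
    qfi fun θ => seqOutput (E θ) C ρ₀ n

/-- (e) Sequential strategies with unital controls and a noiseless ancilla of dimension at most
`N`. -/
def qfiBoundedAncillaSeqUnital (E : ℝ → Op (Fin 2) →ₗ[ℂ] Op (Fin 2)) (N n : ℕ) : ℝ≥0∞ :=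
  ⨆ (a : ℕ) (_ : a ≤ N) (ρ₀ : Op (Fin 2 × Fin a)) (_ : IsState ρ₀)
    (C : ℕ → Op (Fin 2 × Fin a) →ₗ[ℂ] Op (Fin 2 × Fin a)) (_ : ∀ k, IsUnitalChannel (C k)),
    qfi fun θ => seqOutput (ampliate (E θ) (Fin a)) C ρ₀ n

end

end QMetro

open scoped Kronecker

namespace QMetro

/-! If the products `Kᵢ† Kⱼ` do not span, some nonzero Hermitian `A` is orthogonal to all of them,
and `∑ Kᵢ† Kᵢ = 1` makes it traceless. On a qubit `A` is then a multiple of `|u₀⟩⟨u₀| - |u₁⟩⟨u₁|`,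
so the environment cannot distinguish the inputs `u₀` and `u₁`. Hence the coherence `|u₁⟩⟨u₀|`
passes without loss of trace norm, and so does a suitable Hermitian phase combination of it and its
adjoint (`exists_not_contracted`). This contradicts strict contractivity
(`StrictlyContractive.krausSpan_eq`). The Hamiltonian is Hermitian because `∑ Kᵢ† Kᵢ` is constant
near `0`, so it lies in the full Kraus span.

For the Fisher information, membership in the span allows the derivatives of the Kraus operators to
be replaced by `Jᵢ` with `∑ Kᵢ† Jᵢ = 0` (`IsDiffKraus.exists_hasCenteredKraus`). A positive block
operator `G` carries the state, its derivative and a cost, the trace of the last block; four times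
the cost bounds the Fisher information (`HasFisherBound.qfi_le`). Controls preserve the cost
(`HasFisherBound.channel`). A use of the channel adds at most a constant, because centering removes
the cross terms (`HasFisherBound.step`). The constant ignores ancillas, so all strategies follow by
induction on the number of uses. -/

/-! ### Trace norms of qubit operators -/

theorem traceNorm_nonneg {d : Type} [Fintype d] [DecidableEq d] (A : Op d) : 0 ≤ traceNorm A :=
  Finset.sum_nonneg fun _ _ => Real.sqrt_nonneg _

/-- With singular values `s₀`, `s₁`, expand `(s₀ + s₁)²` and use `s₀ s₁ = |det M|`. -/
theorem traceNorm_sq_fin_two (M : Op (Fin 2)) :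
    traceNorm M ^ 2 = (Mᴴ * M).trace.re + 2 * ‖M.det‖ := by
  have hM := Matrix.isHermitian_conjTranspose_mul_self M
  have h0 := (Matrix.posSemidef_conjTranspose_mul_self M).eigenvalues_nonneg 0
  have h1 := (Matrix.posSemidef_conjTranspose_mul_self M).eigenvalues_nonneg 1
  have htr := hM.trace_eq_sum_eigenvalues
  have hdet := hM.det_eq_prod_eigenvalues
  rw [Fin.sum_univ_two] at htr
  rw [Fin.prod_univ_two, Matrix.det_mul, Matrix.det_conjTranspose, RCLike.star_def,
    Complex.conj_mul'] at hdet
  have hdet' : ‖M.det‖ ^ 2 = hM.eigenvalues 0 * hM.eigenvalues 1 := 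
    Complex.ofReal_injective (by push_cast; exact hdet)
  have hs : √(hM.eigenvalues 0) * √(hM.eigenvalues 1) = ‖M.det‖ := by
    rw [← Real.sqrt_mul h0, ← hdet', Real.sqrt_sq (norm_nonneg _)]
  have htr' : (Mᴴ * M).trace.re = hM.eigenvalues 0 + hM.eigenvalues 1 := by
    rw [htr]; simp
  rw [traceNorm, Fin.sum_univ_two, htr', ← hs, add_sq, Real.sq_sqrt h0, Real.sq_sqrt h1]
  ring

theorem exists_phase (z : ℂ) : ∃ w : ℂ, ‖w‖ = 1 ∧ w ^ 2 * z = ‖z‖ := by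
  refine ⟨Complex.exp (-(z.arg / 2 : ℝ) * Complex.I), ?_, ?_⟩
  · rw [← Complex.ofReal_neg, Complex.norm_exp_ofReal_mul_I]
  · conv_lhs => enter [2]; rw [← Complex.norm_mul_exp_arg_mul_I z]
    rw [← Complex.exp_nat_mul, mul_left_comm, ← Complex.exp_add]
    push_cast
    rw [show (2 : ℂ) * (-(z.arg / 2) * Complex.I) + z.arg * Complex.I = 0 by ring]
    simp

/-- Some rotated Hermitian part of a traceless operator on a qubit has the same trace norm as the
operator itself. -/
theorem traceNorm_sq_hermitianPart {Q : Op (Fin 2)} (hQ : Q.trace = 0) {w : ℂ} (hw : ‖w‖ = 1)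
    (hdet : w ^ 2 * (-Q.det) = ‖Q.det‖) :
    traceNorm (w • Q + star w • Qᴴ) ^ 2 = 4 * ((Qᴴ * Q).trace.re + 2 * ‖Q.det‖) := by
  set h := w • Q + star w • Qᴴ with hh
  have hww : w * star w = 1 := by
    rw [RCLike.star_def, Complex.mul_conj']; simp [hw]
  have hherm : hᴴ = h := by
    simp [hh, add_comm]
  have htr : h.trace = 0 := by
    simp [hh, Matrix.trace_add, Matrix.trace_smul, Matrix.trace_conjTranspose, hQ]
  -- By Cayley–Hamilton, a traceless `2 × 2` matrix squares to `-det` times the identity.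
  have htr2 : (h * h).trace = -2 * h.det := by
    rw [Matrix.trace_fin_two] at htr
    have : h 1 1 = - h 0 0 := by linear_combination htr
    simp [Matrix.trace_fin_two, Matrix.mul_apply, Matrix.det_fin_two, this]; ring
  have hconj : star w ^ 2 * (-star Q.det) = ‖Q.det‖ := by
    have := congrArg star hdet
    simpa using this
  -- The phase `w` is chosen so that both contributions `w² tr Q²` and its conjugate equal `2 |det
  -- Q|`.
  have hval : (h * h).trace = 2 * (Qᴴ * Q).trace + 4 * ‖Q.det‖ := by
    have e1 : (Q * Q).trace = -2 * Q.det := by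
      rw [Matrix.trace_fin_two] at hQ
      have : Q 1 1 = - Q 0 0 := by linear_combination hQ
      simp [Matrix.trace_fin_two, Matrix.mul_apply, Matrix.det_fin_two, this]; ring
    have e2 : (Qᴴ * Qᴴ).trace = -2 * star Q.det := by
      rw [← Matrix.conjTranspose_mul, Matrix.trace_conjTranspose, e1]; simp
    have e3 : (Q * Qᴴ).trace = (Qᴴ * Q).trace := Matrix.trace_mul_comm _ _
    simp only [hh, add_mul, mul_add, Matrix.trace_add, Matrix.smul_mul, Matrix.mul_smul,
      Matrix.trace_smul, smul_eq_mul, e1, e2, e3]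
    linear_combination 2 * (Qᴴ * Q).trace * hww + 2 * hdet + 2 * hconj
  have hnn : 0 ≤ (Qᴴ * Q).trace.re :=
    (Complex.le_def.1 (Matrix.posSemidef_conjTranspose_mul_self Q).trace_nonneg).1
  have him : (Qᴴ * Q).trace.im = 0 :=
    ((Complex.le_def.1 (Matrix.posSemidef_conjTranspose_mul_self Q).trace_nonneg).2).symm
  have hre : (h * h).trace = ((2 * (Qᴴ * Q).trace.re + 4 * ‖Q.det‖ : ℝ) : ℂ) := by
    rw [hval]; apply Complex.ext <;> simp [him]
  have hn : 2 * ‖h.det‖ = 2 * (Qᴴ * Q).trace.re + 4 * ‖Q.det‖ := by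
    have h2 : ‖(h * h).trace‖ = 2 * ‖h.det‖ := by rw [htr2]; simp
    rw [← h2, hre, Complex.norm_real, Real.norm_of_nonneg (by positivity)]
  rw [traceNorm_sq_fin_two, hherm, hn, hre, Complex.ofReal_re]
  ring

/-! ### Strict contractivity and the Kraus span -/

theorem IsKraus.sum_conjTranspose_mul {d : Type} [Fintype d] [DecidableEq d] {r : ℕ}
    {Φ : Op d →ₗ[ℂ] Op d} {K : Fin r → Op d} (hK : IsKraus Φ K)
    (hΦ : ∀ X : Op d, (Φ X).trace = X.trace) : ∑ i, (K i)ᴴ * K i = 1 := by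
  rw [Matrix.ext_iff_trace_mul_left]
  intro X
  rw [mul_one, ← hΦ X, hK X, Finset.mul_sum, Matrix.trace_sum, Matrix.trace_sum]
  refine Finset.sum_congr rfl fun i _ => ?_
  rw [← Matrix.mul_assoc, Matrix.trace_mul_comm, ← Matrix.mul_assoc]

/-- If all products `Kᵢ† Kⱼ` have equal diagonal entries, the image of a suitable traceless
Hermitian operator has at least the same trace norm. -/
theorem exists_not_contracted {r : ℕ} (M : Fin r → Op (Fin 2))
    (hM : ∑ i, (M i)ᴴ * M i = 1)
    (heq : ∀ i j, ((M i)ᴴ * M j) 0 0 = ((M i)ᴴ * M j) 1 1) :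
    ∃ B : Op (Fin 2), B.IsHermitian ∧ B.trace = 0 ∧ traceNorm B ^ 2 = 4 ∧
      traceNorm (∑ i, M i * B * (M i)ᴴ) ^ 2 = 4 := by
  -- The columns of `X` and `Y` are the vectors `Mᵢ e₀` and `Mᵢ e₁`; the hypothesis says that their
  -- Gram matrices agree. Below, `P` and `Q` are the images of `|0⟩⟨0|` and `|1⟩⟨0|`.
  let X : Matrix (Fin 2) (Fin r) ℂ := Matrix.of fun a i => M i a 0
  let Y : Matrix (Fin 2) (Fin r) ℂ := Matrix.of fun a i => M i a 1
  have hXY : Xᴴ * X = Yᴴ * Y := by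
    ext i j
    simpa [Matrix.mul_apply, X, Y] using heq i j
  have hP : (X * Xᴴ).trace = 1 := by
    have := congrFun (congrFun hM 0) 0
    rw [Matrix.trace_mul_comm]
    simpa [Matrix.sum_apply, Matrix.mul_apply, X, Matrix.trace] using this
  have hQ : (Y * Xᴴ).trace = 0 := by
    have := congrFun (congrFun hM 0) 1
    rw [Matrix.trace_mul_comm]
    simpa [Matrix.sum_apply, Matrix.mul_apply, X, Y, Matrix.trace] using this
  set Q := Y * Xᴴ with hQdef
  set P := X * Xᴴ with hPdef
  have hQQ : Qᴴ * Q = P * P := by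
    calc Qᴴ * Q = X * (Yᴴ * Y) * Xᴴ := by
          simp [hQdef, Matrix.conjTranspose_mul, Matrix.mul_assoc]
      _ = P * P := by rw [← hXY]; simp [hPdef, Matrix.mul_assoc]
  have hPd : 0 ≤ P.det := (Matrix.posSemidef_self_mul_conjTranspose X).det_nonneg
  have hPn : P.det = (‖P.det‖ : ℂ) := by
    have := Complex.eq_coe_norm_of_nonneg hPd
    simpa using this
  have hdet : ‖Q.det‖ = ‖P.det‖ := by
    have := congrArg (fun A : Op (Fin 2) => ‖A.det‖) hQQ
    simp only [Matrix.det_mul, Matrix.det_conjTranspose, norm_mul, norm_star] at this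
    nlinarith [norm_nonneg Q.det, norm_nonneg P.det, this]
  -- Since `Q† Q = P²` with `P ≥ 0`, the trace norm of `Q` is `tr P = 1`; the left side is its
  -- square.
  have hsum : (Qᴴ * Q).trace.re + 2 * ‖Q.det‖ = 1 := by
    have : (Qᴴ * Q).trace + 2 * (‖Q.det‖ : ℂ) = 1 := by
      rw [hQQ, hdet, ← hPn]
      have : (P * P).trace + 2 * P.det = P.trace ^ 2 := by
        simp [Matrix.trace_fin_two, Matrix.mul_apply, Matrix.det_fin_two]; ring
      rw [this, hP, one_pow]
    have := congrArg Complex.re this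
    simpa using this
  obtain ⟨w, hw, hwd⟩ := exists_phase (-Q.det)
  rw [norm_neg] at hwd
  have hww : w * star w = 1 := by
    rw [RCLike.star_def, Complex.mul_conj']; simp [hw]
  let B : Op (Fin 2) := !![0, star w; w, 0]
  have hB : ∑ i, M i * B * (M i)ᴴ = w • Q + star w • Qᴴ := by
    ext a b
    simp [B, hQdef, Matrix.sum_apply, Matrix.mul_apply, X, Y, Finset.mul_sum,
      ← Finset.sum_add_distrib, Matrix.conjTranspose_mul]
    refine Finset.sum_congr rfl fun i _ => ?_
    ring
  refine ⟨B, ?_, ?_, ?_, ?_⟩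
  · ext a b; fin_cases a <;> fin_cases b <;> simp [B]
  · simp [B, Matrix.trace_fin_two]
  · rw [traceNorm_sq_fin_two]
    simp [B, Matrix.trace_fin_two, Matrix.mul_apply, Matrix.det_fin_two, hw, Complex.conj_mul']
    norm_num
  · rw [hB, traceNorm_sq_hermitianPart hQ hw hwd, hsum, mul_one]

theorem exists_trace_mul_eq {d : Type} [Fintype d] [DecidableEq d] (f : Op d →ₗ[ℂ] ℂ) :
    ∃ C : Op d, ∀ X, f X = (C * X).trace := by
  refine ⟨Matrix.of fun j i => f (Matrix.single i j 1), fun X => ?_⟩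
  conv_lhs => rw [Matrix.matrix_eq_sum_single X]
  simp only [map_sum, Matrix.trace, Matrix.diag, Matrix.mul_apply, Matrix.of_apply]
  rw [Finset.sum_comm]
  refine Finset.sum_congr rfl fun j _ => Finset.sum_congr rfl fun i _ => ?_
  rw [← mul_one (X i j), ← smul_eq_mul, ← Matrix.smul_single, map_smul, smul_eq_mul, smul_eq_mul,
    mul_one, mul_comm]

/-- If the products `Kᵢ† Kⱼ` do not span, a nonzero Hermitian operator is orthogonal to them. -/
theorem exists_isHermitian_orthogonal {d : Type} [Fintype d] [DecidableEq d] {r : ℕ}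
    {K : Fin r → Op d} {X : Op d}
    (hX : X ∉ Submodule.span ℂ (Set.range fun p : Fin r × Fin r => (K p.1)ᴴ * K p.2)) :
    ∃ A : Op d, A.IsHermitian ∧ A ≠ 0 ∧ ∀ i j, (A * ((K i)ᴴ * K j)).trace = 0 := by
  obtain ⟨f, hfX, hf⟩ := Submodule.exists_le_ker_of_notMem hX
  obtain ⟨C, hC⟩ := exists_trace_mul_eq f
  have h1 : ∀ i j, (C * ((K i)ᴴ * K j)).trace = 0 := fun i j => by
    rw [← hC]
    exact hf (Submodule.subset_span ⟨(i, j), rfl⟩)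
  -- The set of products is closed under adjoints, so `C†` is orthogonal to it along with `C`; a
  -- Hermitian combination of the two is nonzero.
  have h2 : ∀ i j, (Cᴴ * ((K i)ᴴ * K j)).trace = 0 := fun i j => by
    have := congrArg star (h1 j i)
    rw [← Matrix.trace_conjTranspose, Matrix.conjTranspose_mul, Matrix.trace_mul_comm] at this
    simpa [Matrix.conjTranspose_mul] using this
  have hC0 : C ≠ 0 := by
    rintro rfl
    exact hfX (by simp [hC])
  by_cases h : C + Cᴴ = 0
  · refine ⟨Complex.I • C, ?_, by simp [hC0], fun i j => by simp [h1]⟩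
    rw [Matrix.IsHermitian, Matrix.conjTranspose_smul, ← neg_eq_of_add_eq_zero_right h]
    simp
  · refine ⟨C + Cᴴ, ?_, h, fun i j => by rw [add_mul, Matrix.trace_add, h1, h2, add_zero]⟩
    simp [Matrix.IsHermitian, add_comm]

theorem StrictlyContractive.krausSpan_eq {Φ : Op (Fin 2) →ₗ[ℂ] Op (Fin 2)}
    (hΦ : StrictlyContractive Φ) (htr : ∀ X, (Φ X).trace = X.trace) {r : ℕ}
    {K : Fin r → Op (Fin 2)} (hK : IsKraus Φ K) : krausSpan K = {X | X.IsHermitian} := by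
  refine Set.Subset.antisymm (fun X hX => hX.1) fun X hX => ⟨hX, ?_⟩
  by_contra hXs
  obtain ⟨A, hA, hA0, hAK⟩ := exists_isHermitian_orthogonal hXs
  have hone := hK.sum_conjTranspose_mul htr
  have hAtr : A.trace = 0 := by
    rw [← mul_one A, ← hone, Finset.mul_sum, Matrix.trace_sum]
    exact Finset.sum_eq_zero fun i _ => hAK i i
  have hsum : hA.eigenvalues 0 + hA.eigenvalues 1 = 0 := by
    have := hA.trace_eq_sum_eigenvalues
    rw [hAtr, Fin.sum_univ_two] at this
    exact Complex.ofReal_injective (by push_cast; exact this.symm)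
  have hspec := hA.spectral_theorem
  rw [Unitary.conjStarAlgAut_apply] at hspec
  set U : Op (Fin 2) := hA.eigenvectorUnitary.1 with hU
  have hUU : Uᴴ * U = 1 := Unitary.coe_star_mul_self hA.eigenvectorUnitary
  set D : Op (Fin 2) := Matrix.diagonal (RCLike.ofReal ∘ hA.eigenvalues) with hD
  have hD0 : hA.eigenvalues 0 ≠ 0 := by
    intro h0
    have h1 : hA.eigenvalues 1 = 0 := by linarith
    have : D = 0 := by
      ext i j; fin_cases i <;> fin_cases j <;> simp [hD, h0, h1]
    exact hA0 (by rw [hspec, this]; simp)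
  have hKU : ∑ i, (K i * U)ᴴ * (K i * U) = 1 := by
    calc ∑ i, (K i * U)ᴴ * (K i * U) = Uᴴ * (∑ i, (K i)ᴴ * K i) * U := by
          simp only [Matrix.conjTranspose_mul, Finset.mul_sum, Finset.sum_mul, Matrix.mul_assoc]
      _ = 1 := by rw [hone, mul_one, hUU]
  -- In the eigenbasis `A` is a nonzero multiple of `diag(1, -1)`, so orthogonality to it equates
  -- the two diagonal entries.
  have heq : ∀ i j, ((K i * U)ᴴ * (K j * U)) 0 0 = ((K i * U)ᴴ * (K j * U)) 1 1 := by
    intro i j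
    have h : (D * ((K i * U)ᴴ * (K j * U))).trace = 0 := by
      rw [← hAK i j, hspec, Matrix.mul_assoc, Matrix.mul_assoc, Matrix.trace_mul_comm U]
      simp only [Matrix.conjTranspose_mul, Matrix.mul_assoc, Matrix.star_eq_conjTranspose]
    rw [Matrix.trace_fin_two, hD, Matrix.diagonal_mul, Matrix.diagonal_mul] at h
    have h1 : hA.eigenvalues 1 = -hA.eigenvalues 0 := by linarith
    simp only [Function.comp_apply, h1] at h
    have h0 : ((hA.eigenvalues 0 : ℝ) : ℂ) ≠ 0 := by exact_mod_cast hD0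
    apply mul_left_cancel₀ h0
    push_cast at h
    linear_combination h
  obtain ⟨B, hB, hBtr, hB4, hEB⟩ := exists_not_contracted (fun i => K i * U) hKU heq
  have hE : Φ (U * B * Uᴴ) = ∑ i, K i * U * B * (K i * U)ᴴ := by
    rw [hK]
    simp only [Matrix.conjTranspose_mul, Matrix.mul_assoc]
  have hdetU : ‖U.det‖ * ‖U.det‖ = 1 := by
    have := congrArg (fun M : Op (Fin 2) => ‖M.det‖) hUU
    simpa using this
  have hn : traceNorm (U * B * Uᴴ) ^ 2 = 4 := by
    rw [← hB4, traceNorm_sq_fin_two, traceNorm_sq_fin_two]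
    congr 2
    · calc ((U * B * Uᴴ)ᴴ * (U * B * Uᴴ)).trace
          = (U * (Bᴴ * (Uᴴ * U) * B * Uᴴ)).trace := by
            simp [Matrix.conjTranspose_mul, Matrix.mul_assoc]
        _ = (Bᴴ * B).trace := by
            rw [hUU, Matrix.trace_mul_comm, Matrix.mul_assoc _ Uᴴ, hUU, mul_one, mul_one]
    · rw [Matrix.det_mul, Matrix.det_mul, Matrix.det_conjTranspose, norm_mul, norm_mul, norm_star]
      linear_combination ‖B.det‖ * hdetU
  have hlt := hΦ (U * B * Uᴴ) ?_ ?_ ?_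
  · rw [← hE] at hEB
    nlinarith [traceNorm_nonneg (Φ (U * B * Uᴴ)), traceNorm_nonneg (U * B * Uᴴ)]
  · exact Matrix.isHermitian_mul_mul_conjTranspose U hB
  · rw [Matrix.trace_mul_comm, ← Matrix.mul_assoc, hUU, one_mul, hBtr]
  · intro h0
    rw [traceNorm_sq_fin_two, h0] at hn
    simp at hn

/-! ### Derivatives of operator-valued functions -/

theorem HasOpDeriv.congr_of_eventuallyEq {d : Type} {A B : ℝ → Op d} {A' : Op d}
    (hA : HasOpDeriv A A') (h : B =ᶠ[𝓝 0] A) : HasOpDeriv B A' := fun i j =>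
  (hA i j).congr_of_eventuallyEq (h.mono fun θ hθ => by simp only [hθ])

theorem hasOpDeriv_const {d : Type} (A : Op d) : HasOpDeriv (fun _ => A) 0 := fun i j =>
  hasDerivAt_const 0 (A i j)

theorem HasOpDeriv.unique {d : Type} {A : ℝ → Op d} {A' A'' : Op d}
    (h : HasOpDeriv A A') (h' : HasOpDeriv A A'') : A' = A'' := by
  ext i j
  exact (h i j).unique (h' i j)

theorem HasOpDeriv.conjTranspose {d : Type} {A : ℝ → Op d} {A' : Op d}
    (h : HasOpDeriv A A') : HasOpDeriv (fun θ => (A θ)ᴴ) A'ᴴ := fun i j => (h j i).star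

theorem HasOpDeriv.sum {d ι : Type} [Fintype ι] {A : ι → ℝ → Op d} {A' : ι → Op d}
    (h : ∀ i, HasOpDeriv (A i) (A' i)) : HasOpDeriv (fun θ => ∑ i, A i θ) (∑ i, A' i) := by
  intro s t
  simp only [Matrix.sum_apply]
  exact HasDerivAt.fun_sum fun i _ => h i s t

theorem HasOpDeriv.mul {d : Type} [Fintype d] {A B : ℝ → Op d} {A' B' : Op d}
    (hA : HasOpDeriv A A') (hB : HasOpDeriv B B') :
    HasOpDeriv (fun θ => A θ * B θ) (A' * B 0 + A 0 * B') := by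
  intro s t
  simp only [Matrix.mul_apply, Matrix.add_apply, ← Finset.sum_add_distrib]
  exact HasDerivAt.fun_sum fun i _ => (hA s i).mul (hB i t)

/-- Product rule for linear maps applied to operators. -/
theorem HasOpDeriv.apply {d : Type} [Fintype d] [DecidableEq d] {Φ : ℝ → Op d →ₗ[ℂ] Op d}
    {Φ' : Op d → Op d} (hΦ : ∀ X, HasOpDeriv (fun θ => Φ θ X) (Φ' X)) {ρ : ℝ → Op d} {ρ' : Op d}
    (hρ : HasOpDeriv ρ ρ') : HasOpDeriv (fun θ => Φ θ (ρ θ)) (Φ' (ρ 0) + Φ 0 ρ') := by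
  have expand : ∀ (Ψ : Op d →ₗ[ℂ] Op d) (X : Op d) (s t : d),
      Ψ X s t = ∑ i, ∑ j, X i j * Ψ (Matrix.single i j 1) s t := by
    intro Ψ X s t
    conv_lhs => rw [Matrix.matrix_eq_sum_single X]
    simp only [map_sum, Matrix.sum_apply]
    refine Finset.sum_congr rfl fun i _ => Finset.sum_congr rfl fun j _ => ?_
    rw [← mul_one (X i j), ← smul_eq_mul, ← Matrix.smul_single, map_smul, Matrix.smul_apply]
    simp
  intro s t
  have h1 : HasDerivAt (fun θ => ∑ i, ∑ j, ρ 0 i j * Φ θ (Matrix.single i j 1) s t)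
      (Φ' (ρ 0) s t) 0 := by
    simpa only [← expand] using hΦ (ρ 0) s t
  -- `Φ'` is not assumed linear; its expansion in matrix units follows from uniqueness of
  -- derivatives.
  have h2 : Φ' (ρ 0) s t = ∑ i, ∑ j, ρ 0 i j * Φ' (Matrix.single i j 1) s t :=
    h1.unique (HasDerivAt.fun_sum fun i _ => HasDerivAt.fun_sum fun j _ =>
      (hΦ _ s t).const_mul _)
  simp only [Matrix.add_apply, h2, expand (Φ 0) ρ', expand _ (ρ _), ← Finset.sum_add_distrib]
  refine HasDerivAt.fun_sum fun i _ => HasDerivAt.fun_sum fun j _ => ?_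
  rw [add_comm]
  exact (hρ i j).mul (hΦ _ s t)

/-- Differentiating `∑ Kᵢ† Kᵢ = 1` shows that `∑ Kᵢ† K'ᵢ` is anti-Hermitian. -/
theorem IsDiffKraus.krausHamiltonian_isHermitian {d : Type} [Fintype d] [DecidableEq d] {r : ℕ}
    {E : ℝ → Op d →ₗ[ℂ] Op d} {K : ℝ → Fin r → Op d} {K' : Fin r → Op d}
    (hE : ∀ᶠ θ in 𝓝 (0 : ℝ), IsChannel (E θ)) (hK : IsDiffKraus E K K') :
    (krausHamiltonian (K 0) K').IsHermitian := by
  have h1 : HasOpDeriv (fun θ => ∑ i, (K θ i)ᴴ * K θ i)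
      (∑ i, ((K' i)ᴴ * K 0 i + (K 0 i)ᴴ * K' i)) :=
    HasOpDeriv.sum fun i => (hK.2 i).conjTranspose.mul (hK.2 i)
  have h2 : HasOpDeriv (fun θ => ∑ i, (K θ i)ᴴ * K θ i) 0 := by
    refine (hasOpDeriv_const (1 : Op d)).congr_of_eventuallyEq ?_
    filter_upwards [hE, hK.1] with θ h h' using h'.sum_conjTranspose_mul h.2
  have h := h1.unique h2
  rw [Finset.sum_add_distrib] at h
  rw [Matrix.IsHermitian, krausHamiltonian, Matrix.conjTranspose_smul, Matrix.conjTranspose_sum]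
  simp only [Matrix.conjTranspose_mul, Matrix.conjTranspose_conjTranspose]
  rw [eq_neg_of_add_eq_zero_left h]
  simp

/-! ### Blocks of operators on a composite system -/

/-- The `(x, y)` block, with respect to the second factor, of an operator on `d × a`. -/
def blk {d a : Type} (G : Op (d × a)) (x y : a) : Op d :=
  Matrix.of fun s t => G (s, x) (t, y)

theorem blk_mul {d a : Type} [Fintype d] [Fintype a] (A B : Op (d × a)) (x y : a) :
    blk (A * B) x y = ∑ u, blk A x u * blk B u y := by
  ext s t
  simp only [blk, Matrix.of_apply, Matrix.mul_apply, Matrix.sum_apply, Fintype.sum_prod_type]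
  exact Finset.sum_comm

theorem blk_conjTranspose {d a : Type} (A : Op (d × a)) (x y : a) : blk Aᴴ x y = (blk A y x)ᴴ := rfl

theorem blk_sum {d a ι : Type} [Fintype ι] (A : ι → Op (d × a)) (x y : a) :
    blk (∑ i, A i) x y = ∑ i, blk (A i) x y := by
  ext s t
  simp [blk, Matrix.sum_apply]

theorem trace_eq_sum_blk {d a : Type} [Fintype d] [Fintype a] (A : Op (d × a)) : A.trace = ∑ x, (blk A x x).trace := by
  simp only [Matrix.trace, Matrix.diag, blk, Matrix.of_apply, Fintype.sum_prod_type]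
  exact Finset.sum_comm

theorem blk_posSemidef {d a : Type} {G : Op (d × a)} (hG : G.PosSemidef) (x : a) : (blk G x x).PosSemidef :=
  hG.submatrix fun s => (s, x)

/-! ### Bounds on the quantum Fisher information -/

/-- `ρ` has trace one at `θ = 0`, and there is a positive extension by a qubit which has `ρ 0` as
diagonal block, the derivative of `ρ` as sum of the off-diagonal blocks, and whose other diagonal
block has trace at most `b`. -/
def HasFisherBound {d : Type} [Fintype d] (ρ : ℝ → Op d) (b : ℝ) : Prop :=
  (ρ 0).trace = 1 ∧ ∃ G : Op (d × Fin 2), G.PosSemidef ∧ blk G 0 0 = ρ 0 ∧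
    HasOpDeriv ρ (blk G 0 1 + blk G 1 0) ∧ (blk G 1 1).trace.re ≤ b

/-- The Lyapunov equation `L R + R L = 2 D` has a Hermitian solution if the compression of `D` to
the kernel of `R` vanishes. -/
theorem exists_lyapunov {d : Type} [Fintype d] [DecidableEq d] {R D : Op d} (hR : R.PosSemidef)
    (hD : D.IsHermitian)
    (hker : ∀ u v : d → ℂ, R *ᵥ u = 0 → R *ᵥ v = 0 → star u ⬝ᵥ (D *ᵥ v) = 0) :
    ∃ L : Op d, L.IsHermitian ∧ (1 / 2 : ℂ) • (L * R + R * L) = D := by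
  set l := hR.1.eigenvalues with hl
  have hl0 : ∀ i, 0 ≤ l i := hR.eigenvalues_nonneg
  have hspec := hR.1.spectral_theorem
  rw [Unitary.conjStarAlgAut_apply] at hspec
  set U : Op d := hR.1.eigenvectorUnitary.1 with hU
  have hUU : Uᴴ * U = 1 := Unitary.coe_star_mul_self hR.1.eigenvectorUnitary
  have hUU' : U * Uᴴ = 1 := Unitary.coe_mul_star_self hR.1.eigenvectorUnitary
  rw [Matrix.star_eq_conjTranspose] at hspec
  set Λ : Op d := Matrix.diagonal (RCLike.ofReal ∘ l) with hΛ
  set D' : Op d := Uᴴ * D * U with hD'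
  have hD'h : D'.IsHermitian := Matrix.isHermitian_conjTranspose_mul_mul U hD
  have hcol : ∀ i, l i = 0 → R *ᵥ (U *ᵥ Pi.single i 1) = 0 := by
    intro i hi
    have : R * U = U * Λ := by rw [hspec, Matrix.mul_assoc, hUU, mul_one]
    rw [Matrix.mulVec_mulVec, this, ← Matrix.mulVec_mulVec, hΛ, Matrix.diagonal_mulVec_single]
    simp [hi]
  have hzero : ∀ i j, l i + l j = 0 → D' i j = 0 := by
    intro i j hij
    have hi : l i = 0 := by linarith [hl0 i, hl0 j]
    have hj : l j = 0 := by linarith [hl0 i, hl0 j]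
    have := hker _ _ (hcol i hi) (hcol j hj)
    rw [Matrix.star_mulVec, Matrix.mulVec_mulVec, Matrix.dotProduct_mulVec,
      Matrix.vecMul_vecMul, ← Matrix.mul_assoc, ← hD', ← Matrix.dotProduct_mulVec] at this
    simpa using this
  -- Entrywise solution in the eigenbasis of `R`. Where the denominator vanishes, so does `D' i j`,
  -- and division by zero gives the harmless value `0`.
  let L' : Op d := Matrix.of fun i j => 2 * D' i j / ((l i + l j : ℝ) : ℂ)
  have hL'h : L'.IsHermitian := by
    ext i j
    have := hD'h.apply i j
    simp only [L', Matrix.conjTranspose_apply, Matrix.of_apply, star_div₀, star_mul', this,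
      RCLike.star_def, Complex.conj_ofReal, Complex.conj_ofNat, add_comm (l j)]
  have hL' : L' * Λ + Λ * L' = (2 : ℂ) • D' := by
    ext i j
    rw [Matrix.add_apply, hΛ, Matrix.mul_diagonal, Matrix.diagonal_mul]
    simp only [L', Matrix.of_apply, Function.comp_apply, Matrix.smul_apply, smul_eq_mul]
    by_cases h : l i + l j = 0
    · simp [hzero i j h]
    · have h' : ((l i + l j : ℝ) : ℂ) ≠ 0 := by exact_mod_cast h
      change 2 * D' i j / ((l i + l j : ℝ) : ℂ) * ((l j : ℝ) : ℂ) +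
        ((l i : ℝ) : ℂ) * (2 * D' i j / ((l i + l j : ℝ) : ℂ)) = 2 * D' i j
      field_simp
      push_cast
      ring
  refine ⟨U * L' * Uᴴ, Matrix.isHermitian_mul_mul_conjTranspose U hL'h, ?_⟩
  calc (1 / 2 : ℂ) • (U * L' * Uᴴ * R + R * (U * L' * Uᴴ))
      = (1 / 2 : ℂ) • (U * (L' * (Uᴴ * U) * Λ + Λ * (Uᴴ * U) * L') * Uᴴ) := by
        rw [hspec]; simp only [mul_add, add_mul, Matrix.mul_assoc]
    _ = U * D' * Uᴴ := by
        rw [hUU, mul_one, mul_one, hL', Matrix.mul_smul, Matrix.smul_mul, smul_smul]; norm_num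
    _ = D := by
        rw [hD', ← Matrix.mul_assoc, ← Matrix.mul_assoc, hUU', one_mul, Matrix.mul_assoc, hUU',
          mul_one]

/-- Positivity of `G` forces its off-diagonal block to vanish on the kernel of `ρ 0`, which yields a
symmetric logarithmic derivative `L`. Compressing `G` by the row `(L, -2)` then gives `0 ≤ F - 2 tr
(ρ' L) + 4 tr G₁₁`, and `tr (ρ' L) = F`. -/
theorem HasFisherBound.qfi_le {d : Type} [Fintype d] {ρ : ℝ → Op d} {b : ℝ}
    (h : HasFisherBound ρ b) : qfi ρ ≤ ENNReal.ofReal (4 * b) := by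
  classical
  obtain ⟨-, G, hG, h00, hder, h11⟩ := h
  have hGh : ∀ x y, (blk G x y)ᴴ = blk G y x := fun x y => by
    rw [← blk_conjTranspose, hG.1]
  have hR : (ρ 0).PosSemidef := h00 ▸ blk_posSemidef hG 0
  have hD : (blk G 0 1 + blk G 1 0).IsHermitian := by
    rw [Matrix.IsHermitian, Matrix.conjTranspose_add, hGh, hGh, add_comm]
  have hkerG : ∀ u, ρ 0 *ᵥ u = 0 → blk G 1 0 *ᵥ u = 0 := by
    intro u hu
    let v : d × Fin 2 → ℂ := fun p => if p.2 = 0 then u p.1 else 0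
    have hv : ∀ x s, (G *ᵥ v) (s, x) = (blk G x 0 *ᵥ u) s := by
      intro x s
      simp [Matrix.mulVec, dotProduct, Fintype.sum_prod_type, v, blk]
    -- The quadratic form of `G` vanishes at `v = u ⊕ 0`, so positivity puts `v` in the kernel of
    -- `G`.
    have hGv : G *ᵥ v = 0 := by
      rw [← hG.dotProduct_mulVec_zero_iff]
      simp only [dotProduct, Fintype.sum_prod_type, hv, Fin.sum_univ_two, h00, hu]
      simp [v]
    ext s
    rw [← hv, hGv]; rfl
  obtain ⟨L, hL, hLD⟩ := exists_lyapunov hR hD (by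
    intro u v hu hv
    rw [Matrix.add_mulVec, hkerG v hv, add_zero, Matrix.dotProduct_mulVec, ← hGh 1 0,
      ← Matrix.star_mulVec, hkerG u hu, star_zero, zero_dotProduct])
  have hSLD : IsSLD ρ L := ⟨hL, by rwa [hLD]⟩
  rw [qfi_eq hSLD]
  refine ENNReal.ofReal_le_ofReal ?_
  let W : Op (d × Fin 2) := Matrix.of fun p q =>
    (if p.2 = 0 then if q.2 = 0 then L else (-2 : ℂ) • 1 else 0) p.1 q.1
  have hW0 : ∀ x, blk W 1 x = 0 := fun x => rfl
  have hW1 : blk W 0 0 = L := rfl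
  have hW2 : blk W 0 1 = (-2 : ℂ) • (1 : Op d) := rfl
  have hpos := (hG.mul_mul_conjTranspose_same W).trace_nonneg
  have hF : (ρ 0 * (L * L)).trace = ((blk G 0 1 + blk G 1 0) * L).trace := by
    rw [← hLD, Matrix.smul_mul, Matrix.trace_smul, add_mul, Matrix.trace_add,
      Matrix.mul_assoc L, Matrix.trace_mul_comm L, Matrix.mul_assoc]
    simp only [smul_eq_mul]; ring
  have hval : (W * G * Wᴴ).trace = -(ρ 0 * (L * L)).trace + 4 * (blk G 1 1).trace := by
    rw [trace_eq_sum_blk]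
    simp only [blk_mul, Fin.sum_univ_two, blk_conjTranspose, hW0, hW1, hW2, h00, hL.eq]
    simp only [add_mul, Matrix.trace_add, Matrix.conjTranspose_smul,
      Matrix.conjTranspose_one, Matrix.smul_mul, Matrix.mul_smul, Matrix.trace_smul, one_mul,
      mul_one, smul_eq_mul, Matrix.conjTranspose_zero, mul_zero, zero_mul, Matrix.trace_zero]
    rw [add_mul, Matrix.trace_add] at hF
    rw [Matrix.trace_mul_comm (L * ρ 0), ← Matrix.mul_assoc, Matrix.trace_mul_comm (L * L),
      Matrix.trace_mul_comm L]
    simp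
    linear_combination 2 * hF
  have := (Complex.le_def.1 hpos).1
  rw [hval] at this
  simp at this
  linarith

theorem HasFisherBound.const {d : Type} [Fintype d] {ρ₀ : Op d} (h : IsState ρ₀) :
    HasFisherBound (fun _ => ρ₀) 0 := by
  refine ⟨h.2, Matrix.of fun p q => if p.2 = 0 ∧ q.2 = 0 then ρ₀ p.1 q.1 else 0, ?_, ?_, ?_, ?_⟩
  · classical
    let V : Matrix (d × Fin 2) d ℂ := Matrix.of fun p s => if p.2 = 0 ∧ p.1 = s then 1 else 0
    convert h.1.mul_mul_conjTranspose_same V using 1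
    ext ⟨s, x⟩ ⟨t, y⟩
    by_cases hx : x = 0 <;> by_cases hy : y = 0 <;> simp [Matrix.mul_apply, V, hx, hy]
  · ext s t
    simp [blk]
  · convert hasOpDeriv_const ρ₀ using 1
    ext s t
    simp [blk]
  · simp [Matrix.trace, blk]

/-- Complete positivity with a qubit ancilla lets `C` act on every block of `G`, and trace
preservation keeps the cost. -/
theorem HasFisherBound.channel {d : Type} [Fintype d] {ρ : ℝ → Op d} {b : ℝ}
    (h : HasFisherBound ρ b) {C : Op d →ₗ[ℂ] Op d} (hC : IsChannel C) :
    HasFisherBound (fun θ => C (ρ θ)) b := by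
  classical
  obtain ⟨htr, G, hG, h00, hder, h11⟩ := h
  have hblk : ∀ x y, blk (ampliate C (Fin 2) G) x y = C (blk G x y) := fun _ _ => rfl
  refine ⟨by rw [hC.2, htr], ampliate C (Fin 2) G, hC.1 2 G hG, by rw [hblk, h00], ?_, ?_⟩
  · have := HasOpDeriv.apply (Φ := fun _ => C) (Φ' := fun _ => 0)
      (fun X => hasOpDeriv_const (C X)) hder
    rwa [zero_add, map_add] at this
  · rwa [hblk, hC.2]

/-- The family `Φ` has at `θ = 0` Kraus operators `K` and a derivative generated by operators `J`
which satisfy `∑ Kᵢ† Jᵢ = 0` and `∑ Jᵢ† Jᵢ ≤ c`. -/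
def HasCenteredKraus {d : Type} [Fintype d] [DecidableEq d] (Φ : ℝ → Op d →ₗ[ℂ] Op d) (c : ℝ) :
    Prop :=
  ∃ (r : ℕ) (K J : Fin r → Op d),
    (∀ X, Φ 0 X = ∑ i, K i * X * (K i)ᴴ) ∧
    (∀ X, HasOpDeriv (fun θ => Φ θ X) (∑ i, (J i * X * (K i)ᴴ + K i * X * (J i)ᴴ))) ∧
    ∑ i, (K i)ᴴ * K i = 1 ∧ ∑ i, (K i)ᴴ * J i = 0 ∧
    ((c : ℂ) • (1 : Op d) - ∑ i, (J i)ᴴ * J i).PosSemidef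

open scoped MatrixOrder Matrix.Norms.L2Operator in
theorem trace_mul_nonneg {d : Type} [Fintype d] {A B : Op d} (hA : A.PosSemidef)
    (hB : B.PosSemidef) : 0 ≤ (A * B).trace := by
  classical
  obtain ⟨M, rfl⟩ := CStarAlgebra.nonneg_iff_eq_star_mul_self.mp hA.nonneg
  rw [Matrix.mul_assoc, Matrix.trace_mul_comm]
  exact (hB.mul_mul_conjTranspose_same M).trace_nonneg

open scoped MatrixOrder Matrix.Norms.L2Operator in
theorem exists_smul_one_sub_posSemidef {d : Type} [Fintype d] [DecidableEq d] {A : Op d}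
    (hA : A.IsHermitian) : ∃ c : ℝ, 0 ≤ c ∧ ((c : ℂ) • (1 : Op d) - A).PosSemidef := by
  refine ⟨‖A‖, norm_nonneg _, ?_⟩
  have := IsSelfAdjoint.le_algebraMap_norm_self (a := A) hA
  rw [Matrix.le_iff, Algebra.algebraMap_eq_smul_one] at this
  rwa [Complex.coe_smul]

/-- Conjugating `G` by the block matrices `[[Kᵢ, 0], [Jᵢ, Kᵢ]]` reproduces the product rule in the
off-diagonal blocks. In the trace of the last block the cross terms contain `∑ Kᵢ† Jᵢ = 0` or its
adjoint, leaving the old cost plus `tr (∑ Jᵢ† Jᵢ ρ) ≤ c`. -/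
theorem HasFisherBound.step {d : Type} [Fintype d] [DecidableEq d] {ρ : ℝ → Op d} {b c : ℝ}
    (h : HasFisherBound ρ b) {Φ : ℝ → Op d →ₗ[ℂ] Op d} (hΦ : HasCenteredKraus Φ c) :
    HasFisherBound (fun θ => Φ θ (ρ θ)) (b + c) := by
  obtain ⟨htr, G, hG, h00, hder, h11⟩ := h
  obtain ⟨r, K, J, hK, hJ, hKK, hKJ, hc⟩ := hΦ
  have hρ : (ρ 0).PosSemidef := h00 ▸ blk_posSemidef hG 0
  have hJK : ∑ i, (J i)ᴴ * K i = 0 := by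
    have := congrArg Matrix.conjTranspose hKJ
    simpa [Matrix.conjTranspose_sum] using this
  let V : Fin r → Op (d × Fin 2) := fun i =>
    Matrix.of fun p q => (!![K i, 0; J i, K i] : Matrix (Fin 2) (Fin 2) (Op d)) p.2 q.2 p.1 q.1
  have hV00 : ∀ i, blk (V i) 0 0 = K i := fun _ => rfl
  have hV01 : ∀ i, blk (V i) 0 1 = 0 := fun _ => rfl
  have hV10 : ∀ i, blk (V i) 1 0 = J i := fun _ => rfl
  have hV11 : ∀ i, blk (V i) 1 1 = K i := fun _ => rfl
  have cyc : ∀ A B C : Op d, (A * B * C).trace = (C * A * B).trace := fun A B C =>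
    Matrix.trace_mul_cycle A B C
  refine ⟨?_, ∑ i, V i * G * (V i)ᴴ, ?_, ?_, ?_, ?_⟩
  · change (Φ 0 (ρ 0)).trace = 1
    rw [hK, Matrix.trace_sum]
    simp only [cyc (K _)]
    rw [← Matrix.trace_sum, ← Finset.sum_mul, hKK, one_mul, htr]
  · exact Matrix.posSemidef_sum _ fun i _ => hG.mul_mul_conjTranspose_same (V i)
  · simp only [blk_sum, blk_mul, blk_conjTranspose, Fin.sum_univ_two, hV00, hV01, hK, h00]
    simp
  · convert HasOpDeriv.apply hJ hder using 1
    simp only [blk_sum, blk_mul, blk_conjTranspose, Fin.sum_univ_two, hV00, hV01, hV10, hV11, hK,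
      h00, ← Finset.sum_add_distrib]
    refine Finset.sum_congr rfl fun i _ => ?_
    simp only [Matrix.conjTranspose_zero, mul_zero, zero_mul, add_zero, add_mul, mul_add]
    abel
  · have key : (blk (∑ i, V i * G * (V i)ᴴ) 1 1).trace =
        ((∑ i, (J i)ᴴ * J i) * ρ 0).trace + (blk G 1 1).trace := by
      simp only [blk_sum, blk_mul, blk_conjTranspose, Fin.sum_univ_two, hV10, hV11, h00,
        add_mul, Matrix.trace_sum, Matrix.trace_add]
      simp only [cyc (J _), cyc (K _), Finset.sum_add_distrib]
      simp only [← Matrix.trace_sum, ← Finset.sum_mul, hKK, hKJ, hJK]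
      simp
    have hle := (Complex.le_def.1 (trace_mul_nonneg hc hρ)).1
    rw [sub_mul, Matrix.smul_mul, one_mul, Matrix.trace_sub, Matrix.trace_smul, htr] at hle
    rw [key]
    simp at hle ⊢
    linarith

/-! ### Centered Kraus operators on composite systems -/

theorem blk_injective {d a : Type} {A B : Op (d × a)} (h : ∀ x y, blk A x y = blk B x y) :
    A = B := by
  ext p q
  exact congrFun (congrFun (h p.2 q.2) p.1) q.1

theorem blk_kronecker_one_mul_mul {d a : Type} [Fintype d] [Fintype a] [DecidableEq a]
    (A B : Op d) (X : Op (d × a)) (x y : a) :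
    blk ((A ⊗ₖ (1 : Op a)) * X * (B ⊗ₖ (1 : Op a))ᴴ) x y = A * blk X x y * Bᴴ := by
  have h : ∀ (A : Op d) (x y : a), blk (A ⊗ₖ (1 : Op a)) x y = if x = y then A else 0 := by
    intro A x y
    ext s t
    by_cases hxy : x = y <;> simp [blk, hxy]
  simp [blk_mul, blk_conjTranspose, h, apply_ite Matrix.conjTranspose]

/-- The constant is unchanged by an ancilla of any size, which makes the final bound uniform in the
ancilla dimension. -/
theorem HasCenteredKraus.ampliate {d a : Type} [Fintype d] [DecidableEq d] [Fintype a]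
    [DecidableEq a] {Φ : ℝ → Op d →ₗ[ℂ] Op d} {c : ℝ} (h : HasCenteredKraus Φ c) :
    HasCenteredKraus (fun θ => QMetro.ampliate (Φ θ) a) c := by
  obtain ⟨r, K, J, hK, hJ, hKK, hKJ, hc⟩ := h
  have hmul : ∀ A B : Fin r → Op d, ∑ i, (A i ⊗ₖ (1 : Op a))ᴴ * (B i ⊗ₖ (1 : Op a)) =
      (∑ i, (A i)ᴴ * B i) ⊗ₖ (1 : Op a) := by
    intro A B
    simp only [Matrix.conjTranspose_kronecker, ← Matrix.mul_kronecker_mul,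
      Matrix.conjTranspose_one, mul_one]
    ext p q
    simp [Matrix.sum_apply, Finset.sum_mul]
  refine ⟨r, fun i => K i ⊗ₖ 1, fun i => J i ⊗ₖ 1, fun X => ?_, fun X p q => ?_, ?_, ?_, ?_⟩
  · refine blk_injective fun x y => ?_
    simp only [blk_sum, blk_kronecker_one_mul_mul]
    exact hK (blk X x y)
  · refine (hJ (blk X p.2 q.2) p.1 q.1).congr_deriv ?_
    simp only [← blk_kronecker_one_mul_mul, Matrix.sum_apply, Matrix.add_apply]
    rfl
  · rw [hmul, hKK, Matrix.one_kronecker_one]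
  · rw [hmul, hKJ, Matrix.zero_kronecker]
  · rw [hmul]
    have h := hc.kronecker (Matrix.PosSemidef.one (n := a) (R := ℂ))
    have e : (c : ℂ) • (1 : Op (d × a)) - (∑ i, (J i)ᴴ * J i) ⊗ₖ (1 : Op a) =
        ((c : ℂ) • (1 : Op d) - ∑ i, (J i)ᴴ * J i) ⊗ₖ (1 : Op a) := by
      rw [← Matrix.one_kronecker_one, ← Matrix.smul_kronecker]
      ext p q
      simp [sub_mul]
    rw [e]
    exact h

/-- Transport of a linear map along a relabelling of the basis. -/
noncomputable def relabel {d d' : Type} (e : d ≃ d') (Φ : Op d' →ₗ[ℂ] Op d') :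
    Op d →ₗ[ℂ] Op d :=
  (Matrix.reindexLinearEquiv ℂ ℂ e.symm e.symm).toLinearMap ∘ₗ Φ ∘ₗ
    (Matrix.reindexLinearEquiv ℂ ℂ e e).toLinearMap

theorem relabel_apply {d d' : Type} (e : d ≃ d') (Φ : Op d' →ₗ[ℂ] Op d') (X : Op d) :
    relabel e Φ X = (Φ (X.submatrix e.symm e.symm)).submatrix e e := rfl

theorem HasCenteredKraus.relabel {d d' : Type} [Fintype d] [DecidableEq d] [Fintype d']
    [DecidableEq d'] (e : d ≃ d') {Φ : ℝ → Op d' →ₗ[ℂ] Op d'} {c : ℝ}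
    (h : HasCenteredKraus Φ c) : HasCenteredKraus (fun θ => QMetro.relabel e (Φ θ)) c := by
  obtain ⟨r, K, J, hK, hJ, hKK, hKJ, hc⟩ := h
  have hmul : ∀ A B : Fin r → Op d', ∑ i, ((A i).submatrix e e)ᴴ * (B i).submatrix e e =
      (∑ i, (A i)ᴴ * B i).submatrix e e := by
    intro A B
    simp only [Matrix.conjTranspose_submatrix, Matrix.submatrix_mul_equiv]
    ext p q
    simp [Matrix.sum_apply]
  have hconj : ∀ (A B : Op d') (X : Op d),
      A.submatrix e e * X * (B.submatrix e e)ᴴ =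
        (A * X.submatrix e.symm e.symm * Bᴴ).submatrix e e := by
    intro A B X
    rw [← Matrix.submatrix_mul_equiv _ _ e e e, ← Matrix.submatrix_mul_equiv _ _ e e e]
    simp [Matrix.conjTranspose_submatrix]
  refine ⟨r, fun i => (K i).submatrix e e, fun i => (J i).submatrix e e, fun X => ?_,
    fun X p q => ?_, ?_, ?_, ?_⟩
  · rw [relabel_apply, hK]
    ext p q
    simp only [hconj, Matrix.sum_apply, Matrix.submatrix_apply]
  · refine (hJ (X.submatrix e.symm e.symm) (e p) (e q)).congr_deriv ?_
    simp only [hconj, Matrix.sum_apply, Matrix.submatrix_apply, Matrix.add_apply]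
  · rw [hmul, hKK, Matrix.submatrix_one_equiv]
  · rw [hmul, hKJ, Matrix.submatrix_zero]; rfl
  · rw [hmul]
    have e1 : (c : ℂ) • (1 : Op d) = ((c : ℂ) • (1 : Op d')).submatrix e e := by
      ext p q
      simp [Matrix.one_apply]
    rw [e1]
    exact hc.submatrix e

/-- Separates probe `i` from the other probes and the ancilla. -/
def probeEquiv (d a : Type) {n : ℕ} (i : Fin n) :
    (Fin n → d) × a ≃ d × (({j : Fin n // j ≠ i} → d) × a) :=
  ((Equiv.funSplitAt i d).prodCongr (Equiv.refl a)).trans (Equiv.prodAssoc _ _ _)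

/-- The other probes count as part of the ancilla, so a parallel use is an ordinary ampliated use.
-/
theorem onProbe_eq_relabel {d a : Type} {n : ℕ} (Φ : Op d →ₗ[ℂ] Op d) (i : Fin n)
    (X : Op ((Fin n → d) × a)) :
    onProbe Φ i X = relabel (probeEquiv d a i) (ampliate Φ _) X := by
  have h : ∀ (p : (Fin n → d) × a) (s : d),
      (probeEquiv d a i).symm (s, (probeEquiv d a i p).2) = (Function.update p.1 i s, p.2) := by
    intro p s
    rw [Equiv.symm_apply_eq]
    refine Prod.ext ?_ (Prod.ext ?_ rfl)
    · simp [probeEquiv]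
    · ext j
      simp [probeEquiv, j.2]
  ext p q
  simp only [onProbe, Matrix.of_apply, relabel_apply, Matrix.submatrix_apply, ampliate,
    LinearMap.coe_mk, AddHom.coe_mk, h]
  simp [probeEquiv]

/-! ### Linear bounds for the strategies -/

theorem HasCenteredKraus.seqOutput {d : Type} [Fintype d] [DecidableEq d]
    {Φ : ℝ → Op d →ₗ[ℂ] Op d} {c : ℝ} (h : HasCenteredKraus Φ c) {C : ℕ → Op d →ₗ[ℂ] Op d}
    (hC : ∀ k, IsChannel (C k)) {ρ₀ : Op d} (hρ : IsState ρ₀) (n : ℕ) :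
    HasFisherBound (fun θ => QMetro.seqOutput (Φ θ) C ρ₀ n) (c * n) := by
  induction n with
  | zero =>
    rw [Nat.cast_zero, mul_zero]
    exact HasFisherBound.const hρ
  | succ k ih =>
    rw [Nat.cast_succ, mul_add, mul_one]
    exact (ih.step h).channel (hC k)

theorem HasCenteredKraus.onAllProbes {d a : Type} [Fintype d] [DecidableEq d] [Fintype a]
    [DecidableEq a] {Φ : ℝ → Op d →ₗ[ℂ] Op d} {c : ℝ} (h : HasCenteredKraus Φ c) {n : ℕ}
    {ρ₀ : Op ((Fin n → d) × a)} (hρ : IsState ρ₀) :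
    HasFisherBound (fun θ => QMetro.onAllProbes (Φ θ) ρ₀) (c * n) := by
  -- The probes are treated one after another; the induction needs arbitrary lists of them.
  have key : ∀ l : List (Fin n),
      HasFisherBound (fun θ => l.foldr (fun i Y => onProbe (Φ θ) i Y) ρ₀) (c * l.length) := by
    intro l
    induction l with
    | nil => simpa using HasFisherBound.const hρ
    | cons i l ih =>
      simp only [List.foldr_cons, List.length_cons, Nat.cast_succ, mul_add, mul_one]
      simp only [onProbe_eq_relabel _ i]
      exact ih.step (h.ampliate.relabel (probeEquiv d a i))
  have h := key (List.finRange n)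
  rwa [List.length_finRange] at h

/-! ### Centering the Kraus derivatives -/

/-- An infinitesimal unitary mixing of the Kraus operators does not change the channel to first
order. -/
theorem sum_smul_exchange {d : Type} [Fintype d] {r : ℕ} {h : Matrix (Fin r) (Fin r) ℂ}
    (hh : h.IsHermitian) (K : Fin r → Op d) (X : Op d) :
    ∑ i, ((Complex.I • ∑ j, h i j • K j) * X * (K i)ᴴ +
      K i * X * (Complex.I • ∑ j, h i j • K j)ᴴ) = 0 := by
  have e : ∀ i j, star (h i j) = h j i := fun i j => hh.apply j i
  simp only [Matrix.conjTranspose_smul, Matrix.conjTranspose_sum, e, Finset.smul_sum,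
    Finset.sum_mul, Finset.mul_sum, Finset.sum_add_distrib, Matrix.smul_mul, Matrix.mul_smul]
  rw [Finset.sum_comm, ← Finset.sum_add_distrib]
  refine Finset.sum_eq_zero fun i _ => ?_
  rw [← Finset.sum_add_distrib]
  refine Finset.sum_eq_zero fun j _ => ?_
  simp

/-- If the Hamiltonian lies in the Kraus span, the derivatives of the Kraus operators can be
centered by a change of Kraus representation. -/
theorem IsDiffKraus.exists_hasCenteredKraus {d : Type} [Fintype d] [DecidableEq d] {r : ℕ}
    {E : ℝ → Op d →ₗ[ℂ] Op d} {K : ℝ → Fin r → Op d} {K' : Fin r → Op d}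
    (hK : IsDiffKraus E K K') (hE : IsChannel (E 0))
    (hspan : krausHamiltonian (K 0) K' ∈ krausSpan (K 0)) :
    ∃ c : ℝ, 0 ≤ c ∧ HasCenteredKraus E c := by
  have hK0 := hK.1.self_of_nhds
  obtain ⟨hH, hmem⟩ := hspan
  obtain ⟨w, hw⟩ := (Submodule.mem_span_range_iff_exists_fun ℂ).1 hmem
  rw [Fintype.sum_prod_type] at hw
  -- The coefficients `w` need not be Hermitian, but the Hamiltonian is, so the adjoint coefficients
  -- represent it too and the average can be used.
  let h : Matrix (Fin r) (Fin r) ℂ :=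
    Matrix.of fun i j => (1 / 2 : ℂ) * (w (i, j) + star (w (j, i)))
  have hh : h.IsHermitian := by
    ext i j
    simp [h, add_comm]
  have hw' : ∑ i, ∑ j, star (w (j, i)) • ((K 0 i)ᴴ * K 0 j) = krausHamiltonian (K 0) K' := by
    rw [← hH.eq, ← hw, Finset.sum_comm]
    simp [Matrix.conjTranspose_sum, Matrix.conjTranspose_mul]
  have hhH : ∑ i, ∑ j, h i j • ((K 0 i)ᴴ * K 0 j) = krausHamiltonian (K 0) K' := by
    simp only [h, Matrix.of_apply, mul_smul, add_smul, smul_add, Finset.sum_add_distrib,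
      ← Finset.smul_sum, hw, hw']
    rw [← add_smul]; norm_num
  let J : Fin r → Op d := fun i => K' i + Complex.I • ∑ j, h i j • K 0 j
  obtain ⟨c, hc0, hc⟩ := exists_smul_one_sub_posSemidef (A := ∑ i, (J i)ᴴ * J i) (by
    simp [Matrix.IsHermitian, Matrix.conjTranspose_sum, Matrix.conjTranspose_mul])
  refine ⟨c, hc0, r, K 0, J, hK0, fun X => ?_, hK0.sum_conjTranspose_mul hE.2, ?_, hc⟩
  · have hd : HasOpDeriv (fun θ => ∑ i, K θ i * X * (K θ i)ᴴ)
        (∑ i, (K' i * X * (K 0 i)ᴴ + K 0 i * X * (K' i)ᴴ)) := by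
      refine HasOpDeriv.sum fun i => ?_
      have := ((hK.2 i).mul (hasOpDeriv_const X)).mul (hK.2 i).conjTranspose
      simpa using this
    refine HasOpDeriv.congr_of_eventuallyEq ?_ (hK.1.mono fun θ hθ => hθ X)
    convert hd using 1
    rw [← add_zero (∑ i, (K' i * X * (K 0 i)ᴴ + K 0 i * X * (K' i)ᴴ)),
      ← sum_smul_exchange hh (K 0) X, ← Finset.sum_add_distrib]
    refine Finset.sum_congr rfl fun i _ => ?_
    simp only [J, Matrix.conjTranspose_add, add_mul, mul_add]
    abel
  -- Here `∑ Kᵢ† K'ᵢ = -i H`, and the mixing term contributes `+ i H`.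
  · have : ∑ i, (K 0 i)ᴴ * J i = ∑ i, (K 0 i)ᴴ * K' i +
        Complex.I • ∑ i, ∑ j, h i j • ((K 0 i)ᴴ * K 0 j) := by
      simp only [J, mul_add, Finset.sum_add_distrib, Matrix.mul_smul, Finset.mul_sum,
        Finset.smul_sum]
    rw [this, hhH, krausHamiltonian, smul_smul, Complex.I_mul_I]
    simp

end QMetro

theorem theorem1 (E : ℝ → QMetro.Op (Fin 2) →ₗ[ℂ] QMetro.Op (Fin 2))
    (hE : ∀ᶠ θ in 𝓝 (0 : ℝ), QMetro.IsChannel (E θ))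
    (hdiff : ∃ (r : ℕ) (K : ℝ → Fin r → QMetro.Op (Fin 2)) (K' : Fin r → QMetro.Op (Fin 2)),
      QMetro.IsDiffKraus E K K')
    (hsc : QMetro.StrictlyContractive (E 0)) :
    (∀ (r : ℕ) (K : Fin r → QMetro.Op (Fin 2)), QMetro.IsKraus (E 0) K →
      QMetro.krausSpan K = {X | X.IsHermitian}) ∧
    ¬ QMetro.HNKS E ∧
    ∃ c : ℝ≥0, ∀ n : ℕ,
      QMetro.qfiAncillaSeq E n ≤ c * n ∧
      QMetro.qfiParallel E n ≤ c * n ∧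
      QMetro.qfiSeqUnital E n ≤ c * n ∧
      QMetro.qfiSeq E n ≤ c * n ∧
      ∀ N : ℕ, QMetro.qfiBoundedAncillaSeqUnital E N n ≤ c * n := by
  have hE0 := hE.self_of_nhds
  have hspan : ∀ (r : ℕ) (K : Fin r → QMetro.Op (Fin 2)), QMetro.IsKraus (E 0) K →
      QMetro.krausSpan K = {X | X.IsHermitian} := fun r K hK => hsc.krausSpan_eq hE0.2 hK
  have hmem : ∀ {r : ℕ} {K : ℝ → Fin r → QMetro.Op (Fin 2)} {K' : Fin r → QMetro.Op (Fin 2)},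
      QMetro.IsDiffKraus E K K' →
      QMetro.krausHamiltonian (K 0) K' ∈ QMetro.krausSpan (K 0) := fun {r K K'} hK => by
    rw [hspan r (K 0) hK.1.self_of_nhds]
    exact hK.krausHamiltonian_isHermitian hE
  refine ⟨hspan, fun ⟨r, K, K', hK, hnot⟩ => hnot (hmem hK), ?_⟩
  obtain ⟨r, K, K', hK⟩ := hdiff
  obtain ⟨c, hc, hcen⟩ := hK.exists_hasCenteredKraus hE0 (hmem hK)
  -- The factor `4` comes from `HasFisherBound.qfi_le`; `c` is the cost of a single use.
  have h4 : 0 ≤ 4 * c := by positivity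
  refine ⟨⟨4 * c, h4⟩, fun n => ?_⟩
  have hbound : ∀ {d : Type} [Fintype d] {ρ : ℝ → QMetro.Op d},
      QMetro.HasFisherBound ρ (c * n) →
      QMetro.qfi ρ ≤ (NNReal.mk (4 * c) h4 : ℝ≥0∞) * n := by
    intro d _ ρ h
    refine h.qfi_le.trans_eq ?_
    rw [← mul_assoc, ENNReal.ofReal_mul (by positivity), ENNReal.ofReal_natCast,
      ENNReal.ofReal_eq_coe_nnreal h4]
  have hamp : ∀ a : ℕ, QMetro.HasCenteredKraus (fun θ => QMetro.ampliate (E θ) (Fin a)) c :=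
    fun a => hcen.ampliate
  refine ⟨?_, ?_, ?_, ?_, fun N => ?_⟩
  · exact iSup_le fun a => iSup₂_le fun ρ₀ hρ => iSup₂_le fun C hC =>
      hbound ((hamp a).seqOutput hC hρ n)
  · exact iSup_le fun a => iSup₂_le fun ρ₀ hρ => hbound (hcen.onAllProbes hρ)
  · exact iSup₂_le fun ρ₀ hρ => iSup₂_le fun C hC =>
      hbound (hcen.seqOutput (fun k => (hC k).1) hρ n)
  · exact iSup₂_le fun ρ₀ hρ => iSup₂_le fun C hC => hbound (hcen.seqOutput hC hρ n)
  · exact iSup₂_le fun a _ => iSup₂_le fun ρ₀ hρ => iSup₂_le fun C hC =>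
      hbound ((hamp a).seqOutput (fun k => (hC k).1) hρ n)
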